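/- **Setting.** Let $T_\Sigma$ be the set of closed terms (moves) built from a constant $e$, unary symbols $l,r$ and a binary symbol $\langle\ ,\ \rangle$. Let $\mathcal P$ be the set of partial involutions on $T_\Sigma$, i.e. partial injective functions $f:T_\Sigma\rightharpoonup T_\Sigma$ with $f(u)=v\Leftrightarrow f(v)=u$, identified with their graphs. For $i,j\in\{l,r\}$ put $f_{ij}=\{(u,v)\mid (i(u),j(v))\in f\}$, and define application by $f\cdot g=f_{rr}\cup(f_{rl};g;(f_{ll};g)^*;f_{lr})$, where $;$ is composition in diagrammatic order. Let $B,C,I,K\in\mathcal P$ consist of the following pairs (in both directions, for all $x\in T_\Sigma$): $B: r^3x\leftrightarrow lrx,\ l^2x\leftrightarrow rlrx,\ rl^2x\leftrightarrow r^2lx$; $C: l^2x\leftrightarrow r^2lx,\ lrlx\leftrightarrow rlx,\ lr^2x\leftrightarrow r^3x$; $I: lx\leftrightarrow rx$; $K: lx\leftrightarrow r^2x$. A *strictly linear combinatory algebra* is a set $A$ with a binary application (written by juxtaposition, associating to the left) and elements $B,C,I$ such that $Bxyz=x(yz)$, $Cxyz=(xz)y$, $Ix=x$ for all $x,y,z\in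 A$; a *strictly affine combinatory algebra* has in addition an element $K$ with $Kxy=x$. The *strictly linear* (resp. *affine*) $\lambda$-calculus has as terms those $\lambda$-terms with constants in which every abstraction $\lambda x.M$ binds exactly one (resp. at most one) free occurrence of $x$ in $M$; its provable equality is the congruence generated by $\beta$ and $\xi$ restricted to such terms. A combinatory term over $A$ is built by application from variables, constants $c_a$ ($a\in A$), and the combinator symbols $B,C,I$ (and $K$ in the affine case). Its translation $(M)_\lambda$ replaces $B,C,I,K$ by $\lambda xyz.x(yz)$, $\lambda xyz.(xz)y$, $\lambda x.x$, $\lambda xy.x$, and leaves variables and the constants $c_a$ unchanged; a closed $M$ has its evident value $[\![M]\!]\in A$, with $[\![c_a]\!]=a$. The algebra is a *strictly linear (affine) $\lambda$-algebra* if, for all closed combinatory terms $M,N$ over $A$, provable equality of $(M)_\lambda$ and $(N)_\lambda$ in the strictly linear (affine) $\lambda$-calculus implies $[\![M]\!]=[\![N]\!]$. It is a *strictly linear (affine) combinatory $\lambda$-model* if it has a *selector*: an element $\epsilon\in A$ such that for all $x,y\in A$, $\epsilon xy=xy$, and $(\forall z\in A.\ xz=yz)$ implies $\epsilon x=\epsilon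 y$. **Theorem.** (i) $(\mathcal P,\cdot)$ with $B,C,I$ is a strictly linear combinatory algebra and a strictly linear $\lambda$-algebra. No $\epsilon\in\mathcal P$ is a selector, so it is not a strictly linear combinatory $\lambda$-model. (ii) $(\mathcal P,\cdot)$ with $B,C,I,K$ is a strictly affine combinatory algebra but not a strictly affine $\lambda$-algebra: $(BBK)_\lambda$ and $(BKK)_\lambda$ are provably equal in the strictly affine $\lambda$-calculus, but $[\![BBK]\!]\neq[\![BKK]\!]$ in $\mathcal P$. -/

import Mathlib

namespace StrictLambda

/-! ### Combinatory logic and lambda calculus, strictly linear and strictly affine -/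

/-- The two fragments. -/
inductive Frag where
  | linear
  | affine

/-- The distinguished combinators of a fragment: `B, C, I`, and also `K` in the affine case. -/
inductive Comb : Frag → Type where
  | B {X : Frag} : Comb X
  | C {X : Frag} : Comb X
  | I {X : Frag} : Comb X
  | K : Comb Frag.affine

universe u

/-- Terms of combinatory logic over the combinators of the fragment `X`, with variables `x₀, x₁, …`
and a constant `c_a` for each `a : A`. -/
inductive CLTerm (X : Frag) (A : Type u) : Type u where
  | var (n : ℕ) : CLTerm X A
  | comb (k : Comb X) : CLTerm X A
  | const (a : A) : CLTerm X A
  | app (M N : CLTerm X A) : CLTerm X A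

/-- Raw lambda terms in de Bruijn notation, with constants in `A`. -/
inductive LTerm (A : Type u) : Type u where
  | var (n : ℕ) : LTerm A
  | const (a : A) : LTerm A
  | app (M N : LTerm A) : LTerm A
  | lam (M : LTerm A) : LTerm A

namespace LTerm

variable {A : Type u}

/-- The number of free occurrences of the variable with index `k`. -/
def occ : ℕ → LTerm A → ℕ
  | k, var n => if n = k then 1 else 0
  | _, const _ => 0
  | k, app M N => occ k M + occ k N
  | k, lam M => occ (k + 1) M

/-- Renaming of free variables. -/
def rename : (ℕ → ℕ) → LTerm A → LTerm A
  | f, var n => var (f n)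
  | _, const a => const a
  | f, app M N => app (rename f M) (rename f N)
  | f, lam M => lam (rename (fun n => Nat.casesOn n 0 (fun m => f m + 1)) M)

/-- The substitution `σ` moved under one binder. -/
def up (σ : ℕ → LTerm A) : ℕ → LTerm A
  | 0 => var 0
  | n + 1 => rename Nat.succ (σ n)

/-- Simultaneous capture-avoiding substitution. -/
def subst : (ℕ → LTerm A) → LTerm A → LTerm A
  | σ, var n => σ n
  | _, const a => const a
  | σ, app M N => app (subst σ M) (subst σ N)
  | σ, lam M => lam (subst (up σ) M)

/-- `M[N/x]`, where `x` is the variable with index `0` of the body `M` of an abstraction. -/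
def inst (M N : LTerm A) : LTerm A :=
  subst (fun n => Nat.casesOn n N var) M

/-- The side condition for abstracting the variable with index `0`: it occurs free exactly once
(linear), respectively at most once (affine). -/
def Abstractable : Frag → LTerm A → Prop
  | Frag.linear, M => occ 0 M = 1
  | Frag.affine, M => occ 0 M ≤ 1

/-- Membership in the language of the strictly linear (affine) lambda calculus. -/
def WF (X : Frag) : LTerm A → Prop
  | var _ => True
  | const _ => True
  | app M N => WF X M ∧ WF X N
  | lam M => WF X M ∧ Abstractable X M

/-- Provable equality of the strictly linear (affine) lambda calculus. -/
inductive Eqv (X : Frag) : LTerm A → LTerm A → Prop where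
  | beta {M N : LTerm A} : WF X (lam M) → WF X N → Eqv X (app (lam M) N) (inst M N)
  | xi {M N : LTerm A} : Eqv X M N → Abstractable X M → Abstractable X N →
      Eqv X (lam M) (lam N)
  | app {M M' N N' : LTerm A} : Eqv X M M' → Eqv X N N' → Eqv X (app M N) (app M' N')
  | refl {M : LTerm A} : WF X M → Eqv X M M
  | symm {M N : LTerm A} : Eqv X M N → Eqv X N M
  | trans {M N P : LTerm A} : Eqv X M N → Eqv X N P → Eqv X M P

end LTerm

/-- The lambda term of a combinator:
`B = λxyz.x(yz)`, `C = λxyz.(xz)y`, `I = λx.x`, `K = λxy.x`. -/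
def Comb.toLam {X : Frag} {A : Type u} : Comb X → LTerm A
  | .B => .lam (.lam (.lam (.app (.var 2) (.app (.var 1) (.var 0)))))
  | .C => .lam (.lam (.lam (.app (.app (.var 2) (.var 0)) (.var 1))))
  | .I => .lam (.var 0)
  | .K => .lam (.lam (.var 1))

namespace CLTerm

variable {X : Frag} {A : Type u}

/-- The translation into lambda terms: each combinator is replaced by its lambda term. -/
def toLam : CLTerm X A → LTerm A
  | var n => .var n
  | comb k => k.toLam
  | const a => .const a
  | app M N => .app (toLam M) (toLam N)

/-- No variable occurs. -/
def IsClosed : CLTerm X A → Prop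
  | var _ => False
  | comb _ => True
  | const _ => True
  | app M N => IsClosed M ∧ IsClosed N

end CLTerm

/-! ### Combinatory algebras, lambda algebras, combinatory models -/

/-- An applicative structure with distinguished elements for the combinators of `X`;
the laws are in `IsCombAlgebra`. -/
structure CombStructure (X : Frag) (A : Type u) where
  app : A → A → A
  comb : Comb X → A

namespace CombStructure

variable {X : Frag} {A : Type u}

/-- The equations of the combinators `B`, `C`, `I`. -/
structure SatisfiesBCI (𝒜 : CombStructure X A) : Prop where
  B_law : ∀ x y z : A,
    𝒜.app (𝒜.app (𝒜.app (𝒜.comb .B) x) y) z = 𝒜.app x (𝒜.app y z)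
  C_law : ∀ x y z : A,
    𝒜.app (𝒜.app (𝒜.app (𝒜.comb .C) x) y) z = 𝒜.app (𝒜.app x z) y
  I_law : ∀ x : A, 𝒜.app (𝒜.comb .I) x = x

/-- Strictly linear (affine) combinatory algebras. -/
def IsCombAlgebra : {X : Frag} → CombStructure X A → Prop
  | .linear, 𝒜 => 𝒜.SatisfiesBCI
  | .affine, 𝒜 => 𝒜.SatisfiesBCI ∧ ∀ x y : A, 𝒜.app (𝒜.app (𝒜.comb .K) x) y = x

/-- The interpretation of a term under a valuation of its variables; for a closed term it does not
depend on the valuation. -/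
def interp (𝒜 : CombStructure X A) (ρ : ℕ → A) : CLTerm X A → A
  | .var n => ρ n
  | .comb k => 𝒜.comb k
  | .const a => a
  | .app M N => 𝒜.app (interp 𝒜 ρ M) (interp 𝒜 ρ N)

/-- Strictly linear (affine) lambda algebras: closed terms, with constants from `A`, whose
translations are provably equal have equal interpretations. -/
def IsLambdaAlgebra (𝒜 : CombStructure X A) : Prop :=
  𝒜.IsCombAlgebra ∧
    ∀ M N : CLTerm X A, M.IsClosed → N.IsClosed →
      LTerm.Eqv X M.toLam N.toLam → ∀ ρ : ℕ → A, 𝒜.interp ρ M = 𝒜.interp ρ N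

/-- `ε` is a selector: `εxy = xy`, and `εx = εy` whenever `x` and `y` have the same applicative
behaviour. -/
def IsSelector (𝒜 : CombStructure X A) (ε : A) : Prop :=
  (∀ x y : A, 𝒜.app (𝒜.app ε x) y = 𝒜.app x y) ∧
    ∀ x y : A, (∀ z : A, 𝒜.app x z = 𝒜.app y z) → 𝒜.app ε x = 𝒜.app ε y

/-- Strictly linear (affine) combinatory lambda models. -/
def IsCombinatoryModel (𝒜 : CombStructure X A) : Prop :=
  𝒜.IsCombAlgebra ∧ ∃ ε : A, 𝒜.IsSelector ε

end CombStructure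

/-! ### Partial involutions -/

/-- The language of moves: one constant, two unary symbols, one binary symbol. -/
inductive Move where
  | e : Move
  | l (t : Move) : Move
  | r (t : Move) : Move
  | pair (s t : Move) : Move

/-- Partial involutions on moves, given by their graphs: partial functions `f` with
`f(u) = v ↔ f(v) = u`. Injectivity follows from the two fields. -/
@[ext]
structure PInv where
  rel : Move → Move → Prop
  symm : ∀ {u v : Move}, rel u v → rel v u
  functional : ∀ {u v w : Move}, rel u v → rel u w → v = w

namespace PInv

/-- `f_{ij} = {(u, v) | (i(u), j(v)) ∈ f}`. -/
def part (f : PInv) (i j : Move → Move) (u v : Move) : Prop := f.rel (i u) (j v)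

open Relation in
/-- The graph of the linear application
`f · g = f_rr ∪ (f_rl ; g ; (f_ll ; g)^* ; f_lr)`, where `;` is composition in diagram order. -/
def appRel (f g : PInv) (u v : Move) : Prop :=
  f.part .r .r u v ∨
    Comp (Comp (Comp (f.part .r .l) g.rel) (ReflTransGen (Comp (f.part .l .l) g.rel)))
      (f.part .l .r) u v

theorem loop_symm (f g : PInv) {a b d : Move} (hab : g.rel a b)
    (h : Relation.ReflTransGen (Relation.Comp (f.part .l .l) g.rel) b d) :
    ∃ c, g.rel d c ∧ Relation.ReflTransGen (Relation.Comp (f.part .l .l) g.rel) c a := by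
  induction h with
  | refl => exact ⟨a, g.symm hab, .refl⟩
  | tail _ h2 ih =>
    obtain ⟨c, hc, hca⟩ := ih
    obtain ⟨x, hx, hxd⟩ := h2
    exact ⟨x, g.symm hxd, .head ⟨_, f.symm hx, hc⟩ hca⟩

theorem appRel_symm (f g : PInv) {u v : Move} (h : appRel f g u v) : appRel f g v u := by
  rcases h with h | ⟨d, ⟨b, ⟨a, h1, h2⟩, h3⟩, h4⟩
  · exact Or.inl (f.symm h)
  · obtain ⟨c, hc, hca⟩ := loop_symm f g h2 h3
    exact Or.inr ⟨a, ⟨c, ⟨d, f.symm h4, hc⟩, hca⟩, f.symm h1⟩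

theorem loop_functional (f g : PInv) {b d d' v w : Move}
    (h : Relation.ReflTransGen (Relation.Comp (f.part .l .l) g.rel) b d)
    (h' : Relation.ReflTransGen (Relation.Comp (f.part .l .l) g.rel) b d')
    (hv : f.part .l .r d v) (hw : f.part .l .r d' w) : v = w := by
  induction h using Relation.ReflTransGen.head_induction_on with
  | refl =>
    rcases Relation.ReflTransGen.cases_head h' with rfl | ⟨c, ⟨x, hx, _⟩, _⟩
    · exact Move.r.inj (f.functional hv hw)
    · cases f.functional hv hx
  | head h1 _ ih =>
    obtain ⟨x, hx, hxc⟩ := h1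
    rcases Relation.ReflTransGen.cases_head h' with rfl | ⟨c, ⟨y, hy, hyc⟩, h2⟩
    · cases f.functional hx hw
    · cases Move.l.inj (f.functional hx hy)
      cases g.functional hxc hyc
      exact ih h2

theorem appRel_functional (f g : PInv) {u v w : Move}
    (h : appRel f g u v) (h' : appRel f g u w) : v = w := by
  rcases h with h | ⟨d, ⟨b, ⟨a, h1, h2⟩, h3⟩, h4⟩ <;>
    rcases h' with h' | ⟨d', ⟨b', ⟨a', h1', h2'⟩, h3'⟩, h4'⟩
  · exact Move.r.inj (f.functional h h')
  · cases f.functional h h1'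
  · cases f.functional h1 h'
  · cases Move.l.inj (f.functional h1 h1')
    cases g.functional h2 h2'
    exact loop_functional f g h3 h3' h4 h4'

/-- Linear application of partial involutions. -/
def app (f g : PInv) : PInv where
  rel := appRel f g
  symm := appRel_symm f g
  functional := appRel_functional f g

open Move

/-- The pairs `u ↔ v` of a combinator, each listed in one direction:
* `B : r³x ↔ lrx, l²x ↔ rlrx, rl²x ↔ r²lx`
* `C : l²x ↔ r²lx, lrlx ↔ rlx, lr²x ↔ r³x`
* `I : lx ↔ rx`
* `K : lx ↔ r²x` -/
def pairs {X : Frag} : Comb X → Move → Move → Prop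
  | .B, u, v => ∃ x, (u = r (r (r x)) ∧ v = l (r x)) ∨ (u = l (l x) ∧ v = r (l (r x))) ∨
      (u = r (l (l x)) ∧ v = r (r (l x)))
  | .C, u, v => ∃ x, (u = l (l x) ∧ v = r (r (l x))) ∨ (u = l (r (l x)) ∧ v = r (l x)) ∨
      (u = l (r (r x)) ∧ v = r (r (r x)))
  | .I, u, v => ∃ x, u = l x ∧ v = r x
  | .K, u, v => ∃ x, u = l x ∧ v = r (r x)

theorem pairs_functional {X : Frag} (k : Comb X) {u v w : Move}
    (h : pairs k u v ∨ pairs k v u) (h' : pairs k u w ∨ pairs k w u) : v = w := by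
  cases k <;> simp only [pairs] at h h' <;> grind (splits := 20)

/-- The partial involution of a combinator. -/
def comb {X : Frag} (k : Comb X) : PInv where
  rel u v := pairs k u v ∨ pairs k v u
  symm := Or.symm
  functional := pairs_functional k

/-- The strictly linear (affine) structure of partial involutions. -/
def structureP (X : Frag) : CombStructure X PInv where
  app := app
  comb := comb

end PInv

/-- The term `BBK`. -/
def BBK (A : Type u) : CLTerm Frag.affine A :=
  .app (.app (.comb .B) (.comb .B)) (.comb .K)

/-- The term `BKK`. -/
def BKK (A : Type u) : CLTerm Frag.affine A :=
  .app (.app (.comb .B) (.comb .K)) (.comb .K)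

end StrictLambda

/-!
Let the moves of a partial involution circulate also through named ports. The resulting port
relations have an application that extends the one of `𝒫`, and every wire at an unused port is a
generic argument: an element whose moves all belong to one argument or to the result is determined
by its value there. Hence `BI` is a selector for port relations, and in the linear case `B`, `C`,
`I` are the values of their own lambda terms, so that provable equality is sound for port relations
and therefore for `𝒫`, which embeds.

In `𝒫` itself there is no generic argument. A selector has to copy its argument, also on moves of
the form `l x`; but the pair `l e ↔ l e` alone has no applicative behaviour and is not distinguished
from the empty involution. In the affine case the argument breaks down because `K x y = x` does not
hold if `y` has ports, such as a generic argument.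
-/

namespace StrictLambda

/-! ### Lambda terms in structures with a selector -/

universe u v

variable {X : Frag} {A : Type u} {B : Type v}

/-- The environment `a, ρ 0, ρ 1, …`, for entering a binder. -/
def extend (a : A) (ρ : ℕ → A) : ℕ → A
  | 0 => a
  | n + 1 => ρ n

namespace CLTerm

/-- The number of occurrences of the variable `xₖ`. -/
def occ (k : ℕ) : CLTerm X A → ℕ
  | var n => if n = k then 1 else 0
  | comb _ => 0
  | const _ => 0
  | app M N => occ k M + occ k N

end CLTerm

namespace CombStructure

variable {𝒜 : CombStructure X A}

theorem IsCombAlgebra.satisfiesBCI (h𝒜 : 𝒜.IsCombAlgebra) : 𝒜.SatisfiesBCI := by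
  cases X with
  | linear => exact h𝒜
  | affine => exact h𝒜.1

theorem exists_lower (𝒜 : CombStructure X A) (P : CLTerm X A) (hP : P.occ 0 = 0) :
    ∃ Q : CLTerm X A, (∀ ρ a, 𝒜.interp ρ Q = 𝒜.interp (extend a ρ) P) ∧
      ∀ n, Q.occ n = P.occ (n + 1) := by
  induction P with
  | var n =>
    cases n with
    | zero => simp [CLTerm.occ] at hP
    | succ n => exact ⟨.var n, fun _ _ => rfl, fun k => by simp [CLTerm.occ]⟩
  | comb k => exact ⟨.comb k, fun _ _ => rfl, fun _ => rfl⟩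
  | const c => exact ⟨.const c, fun _ _ => rfl, fun _ => rfl⟩
  | app M N ihM ihN =>
    obtain ⟨hM, hN⟩ := Nat.add_eq_zero_iff.1 hP
    obtain ⟨M', hM', hM'occ⟩ := ihM hM
    obtain ⟨N', hN', hN'occ⟩ := ihN hN
    exact ⟨.app M' N', fun ρ a => congrArg₂ 𝒜.app (hM' ρ a) (hN' ρ a),
      fun n => congrArg₂ (· + ·) (hM'occ n) (hN'occ n)⟩

theorem SatisfiesBCI.exists_abstraction (h𝒜 : 𝒜.SatisfiesBCI) (P : CLTerm X A)
    (hP : P.occ 0 = 1) :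
    ∃ Q : CLTerm X A, (∀ ρ a, 𝒜.app (𝒜.interp ρ Q) a = 𝒜.interp (extend a ρ) P) ∧
      ∀ n, Q.occ n = P.occ (n + 1) := by
  induction P with
  | var n =>
    obtain rfl : n = 0 := by simpa [CLTerm.occ] using hP
    exact ⟨.comb .I, fun _ a => h𝒜.I_law a, fun _ => rfl⟩
  | comb k => simp [CLTerm.occ] at hP
  | const c => simp [CLTerm.occ] at hP
  | app M N ihM ihN =>
    rcases Nat.add_eq_one_iff.1 hP with ⟨hM, hN⟩ | ⟨hM, hN⟩
    · obtain ⟨M', hM', hM'occ⟩ := 𝒜.exists_lower M hM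
      obtain ⟨N', hN', hN'occ⟩ := ihN hN
      refine ⟨.app (.app (.comb .B) M') N', fun ρ a => ?_, fun n => ?_⟩
      · simp only [interp, h𝒜.B_law, hM' ρ a, hN' ρ a]
      · simp only [CLTerm.occ, hM'occ, hN'occ, zero_add]
    · obtain ⟨M', hM', hM'occ⟩ := ihM hM
      obtain ⟨N', hN', hN'occ⟩ := 𝒜.exists_lower N hN
      refine ⟨.app (.app (.comb .C) M') N', fun ρ a => ?_, fun n => ?_⟩
      · simp only [interp, h𝒜.C_law, hM' ρ a, hN' ρ a]
      · simp only [CLTerm.occ, hM'occ, hN'occ, zero_add]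

theorem IsCombAlgebra.exists_abstraction {C : Type*} {M : LTerm C} (h𝒜 : 𝒜.IsCombAlgebra)
    (hM : LTerm.Abstractable X M) (P : CLTerm X A) (hP : P.occ 0 = M.occ 0) :
    ∃ Q : CLTerm X A, (∀ ρ a, 𝒜.app (𝒜.interp ρ Q) a = 𝒜.interp (extend a ρ) P) ∧
      ∀ n, Q.occ n = P.occ (n + 1) := by
  cases X with
  | linear => exact h𝒜.exists_abstraction P (hP.trans hM)
  | affine =>
    rcases Nat.le_one_iff_eq_zero_or_eq_one.1 (hP.trans_le hM) with h | h
    · obtain ⟨Q, hQ, hQocc⟩ := 𝒜.exists_lower P h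
      refine ⟨.app (.comb .K) Q, fun ρ a => ?_, fun n => ?_⟩
      · simp only [interp, h𝒜.2, hQ ρ a]
      · simp only [CLTerm.occ, hQocc, zero_add]
    · exact h𝒜.1.exists_abstraction P h

/-- The interpretation of the abstraction of a function `F` in a structure with selector `ε`:
`ε f` for an element `f` that represents `F`. The value is junk if there is none. -/
noncomputable def abs (𝒜 : CombStructure X A) (ε : A) (F : A → A) : A :=
  𝒜.app ε (@Classical.epsilon A ⟨ε⟩ fun f => ∀ a, 𝒜.app f a = F a)

theorem IsSelector.abs_eq {ε f : A} {F : A → A} (hε : 𝒜.IsSelector ε)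
    (hf : ∀ a, 𝒜.app f a = F a) : 𝒜.abs ε F = 𝒜.app ε f :=
  hε.2 _ _ fun a => (Classical.epsilon_spec (p := fun f => ∀ a, 𝒜.app f a = F a) ⟨f, hf⟩ a).trans
    (hf a).symm

variable {ℬ : CombStructure X B} {ε : B} {φ : A → B}

/-- The interpretation of lambda terms in a structure with selector `ε`, where `φ` interprets the
constants. -/
noncomputable def den (ℬ : CombStructure X B) (ε : B) (φ : A → B) : (ℕ → B) → LTerm A → B
  | ρ, .var n => ρ n
  | _, .const a => φ a
  | ρ, .app M N => ℬ.app (den ℬ ε φ ρ M) (den ℬ ε φ ρ N)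
  | ρ, .lam M => ℬ.abs ε fun b => den ℬ ε φ (extend b ρ) M

theorem den_rename (M : LTerm A) (f : ℕ → ℕ) (ρ : ℕ → B) :
    ℬ.den ε φ ρ (M.rename f) = ℬ.den ε φ (ρ ∘ f) M := by
  induction M generalizing f ρ with
  | var n => rfl
  | const a => rfl
  | app M N ihM ihN => simp only [LTerm.rename, den, ihM, ihN]
  | lam M ih =>
    simp only [LTerm.rename, den, ih]
    congr! 3 with b
    ext1 n
    cases n <;> rfl

theorem den_subst (M : LTerm A) (σ : ℕ → LTerm A) (ρ : ℕ → B) :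
    ℬ.den ε φ ρ (M.subst σ) = ℬ.den ε φ (fun n => ℬ.den ε φ ρ (σ n)) M := by
  induction M generalizing σ ρ with
  | var n => rfl
  | const a => rfl
  | app M N ihM ihN => simp only [LTerm.subst, den, ihM, ihN]
  | lam M ih =>
    simp only [LTerm.subst, den, ih]
    congr! 3 with b
    ext1 n
    cases n with
    | zero => rfl
    | succ n => exact den_rename _ _ _

theorem den_inst (M N : LTerm A) (ρ : ℕ → B) :
    ℬ.den ε φ ρ (M.inst N) = ℬ.den ε φ (extend (ℬ.den ε φ ρ N) ρ) M := by
  rw [LTerm.inst, den_subst]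
  congr 1
  ext1 n
  cases n <;> rfl

theorem IsCombAlgebra.exists_interp_eq_den (hℬ : ℬ.IsCombAlgebra) (hε : ℬ.IsSelector ε)
    (φ : A → B) {M : LTerm A} (hM : M.WF X) :
    ∃ P : CLTerm X B, (∀ ρ, ℬ.interp ρ P = ℬ.den ε φ ρ M) ∧ ∀ n, P.occ n = M.occ n := by
  induction M with
  | var n => exact ⟨.var n, fun _ => rfl, fun _ => rfl⟩
  | const a => exact ⟨.const (φ a), fun _ => rfl, fun _ => rfl⟩
  | app M N ihM ihN =>
    obtain ⟨P, hP, hPocc⟩ := ihM hM.1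
    obtain ⟨Q, hQ, hQocc⟩ := ihN hM.2
    exact ⟨.app P Q, fun ρ => congrArg₂ ℬ.app (hP ρ) (hQ ρ),
      fun n => congrArg₂ (· + ·) (hPocc n) (hQocc n)⟩
  | lam M ih =>
    obtain ⟨P, hP, hPocc⟩ := ih hM.1
    obtain ⟨Q, hQ, hQocc⟩ := hℬ.exists_abstraction hM.2 P (hPocc 0)
    refine ⟨.app (.const ε) Q, fun ρ => ?_, fun n => ?_⟩
    · exact (hε.abs_eq fun b => (hQ ρ b).trans (hP _)).symm
    · simp only [CLTerm.occ, LTerm.occ, zero_add, hQocc, hPocc]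

theorem IsCombAlgebra.den_beta (hℬ : ℬ.IsCombAlgebra) (hε : ℬ.IsSelector ε) {M : LTerm A}
    (hM : (LTerm.lam M).WF X) (N : LTerm A) (ρ : ℕ → B) :
    ℬ.den ε φ ρ (.app (.lam M) N) = ℬ.den ε φ ρ (M.inst N) := by
  obtain ⟨P, hP, hPocc⟩ := hℬ.exists_interp_eq_den hε φ hM.1
  obtain ⟨Q, hQ, -⟩ := hℬ.exists_abstraction hM.2 P (hPocc 0)
  have hQM (b : B) : ℬ.app (ℬ.interp ρ Q) b = ℬ.den ε φ (extend b ρ) M :=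
    (hQ ρ b).trans (hP _)
  rw [den, den, hε.abs_eq hQM, hε.1, hQM, den_inst]

theorem IsCombAlgebra.den_eq_of_eqv (hℬ : ℬ.IsCombAlgebra) (hε : ℬ.IsSelector ε)
    {M N : LTerm A} (h : LTerm.Eqv X M N) (ρ : ℕ → B) : ℬ.den ε φ ρ M = ℬ.den ε φ ρ N := by
  induction h generalizing ρ with
  | beta hM _ => exact hℬ.den_beta hε hM _ ρ
  | xi _ _ _ ih => exact congrArg (ℬ.abs ε) (funext fun _ => ih _)
  | app _ _ ihM ihN => exact congrArg₂ ℬ.app (ihM ρ) (ihN ρ)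
  | refl _ => rfl
  | symm _ ih => exact (ih ρ).symm
  | trans _ _ ih₁ ih₂ => exact (ih₁ ρ).trans (ih₂ ρ)

/-- Homomorphisms of structures with the combinators of `X`. -/
structure IsHom (𝒜 : CombStructure X A) (ℬ : CombStructure X B) (φ : A → B) : Prop where
  map_app : ∀ a b : A, φ (𝒜.app a b) = ℬ.app (φ a) (φ b)
  map_comb : ∀ k : Comb X, φ (𝒜.comb k) = ℬ.comb k

/-- The combinators are the interpretations of their lambda terms. A selector alone does not
guarantee this: the laws determine the combinators only up to applicative behaviour. -/
def IsStable (ℬ : CombStructure X B) (ε : B) : Prop :=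
  ∀ k : Comb X, ∀ ρ : ℕ → B, ℬ.den ε id ρ k.toLam = ℬ.comb k

theorem SatisfiesBCI.of_injective (hφ : 𝒜.IsHom ℬ φ) (hinj : φ.Injective)
    (hℬ : ℬ.SatisfiesBCI) : 𝒜.SatisfiesBCI where
  B_law x y z := hinj <| by simp only [hφ.map_app, hφ.map_comb, hℬ.B_law]
  C_law x y z := hinj <| by simp only [hφ.map_app, hφ.map_comb, hℬ.C_law]
  I_law x := hinj <| by simp only [hφ.map_app, hφ.map_comb, hℬ.I_law]

theorem den_toLam_comb (φ : A → B) (ρ : ℕ → B) (k : Comb X) :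
    ℬ.den ε φ ρ k.toLam = ℬ.den ε id ρ k.toLam := by
  cases k <;> rfl

theorem IsHom.den_toLam (hφ : 𝒜.IsHom ℬ φ) (hε : ℬ.IsStable ε) (M : CLTerm X A) (ρ : ℕ → A) :
    ℬ.den ε φ (φ ∘ ρ) M.toLam = φ (𝒜.interp ρ M) := by
  induction M with
  | var n => rfl
  | comb k => exact (den_toLam_comb _ _ k).trans ((hε k _).trans (hφ.map_comb k).symm)
  | const a => rfl
  | app M N ihM ihN => simp only [CLTerm.toLam, den, interp, hφ.map_app, ihM, ihN]

theorem IsHom.interp_eq_of_eqv (hφ : 𝒜.IsHom ℬ φ) (hinj : φ.Injective) (hℬ : ℬ.IsCombAlgebra)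
    (hε : ℬ.IsSelector ε) (hstable : ℬ.IsStable ε) {M N : CLTerm X A}
    (h : LTerm.Eqv X M.toLam N.toLam) (ρ : ℕ → A) : 𝒜.interp ρ M = 𝒜.interp ρ N := by
  apply hinj
  rw [← hφ.den_toLam hstable, ← hφ.den_toLam hstable, hℬ.den_eq_of_eqv hε h]

end CombStructure

end StrictLambda

namespace StrictLambda

/-! ### Execution -/

open Relation

section Exec

variable {S T P Q : Type*}

/-- Paths that start and end with a step in `E` and alternate between steps in `E` and in `c`. -/
inductive Path (E c : S → S → Prop) : S → S → Prop
  | single {s t : S} : E s t → Path E c s t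
  | cons {s t u v : S} : E s t → c t u → Path E c u v → Path E c s v

theorem Path.append {E c : S → S → Prop} {s t u v : S} (h : Path E c s t) (htu : c t u)
    (h' : Path E c u v) : Path E c s v := by
  induction h with
  | single hE => exact .cons hE htu h'
  | cons hE hc _ ih => exact .cons hE hc (ih htu)

theorem path_eq_comp (E c : S → S → Prop) :
    Path E c = Comp E (ReflTransGen (Comp c E)) := by
  ext s t
  constructor
  · intro h
    induction h with
    | single h => exact ⟨_, h, .refl⟩
    | cons h hc _ ih =>
      obtain ⟨w, hw, hwt⟩ := ih
      exact ⟨_, h, .head ⟨_, hc, hw⟩ hwt⟩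
  · rintro ⟨u, hsu, hut⟩
    induction hut using ReflTransGen.head_induction_on generalizing s with
    | refl => exact .single hsu
    | head h _ ih =>
      obtain ⟨w, hw, hwu⟩ := h
      exact .cons hsu hw (ih _ hwu)

/-- Execution: the relation on interface points `P` obtained from a box `E` with internal points
`S` by letting information circulate along the links `c`; `X p s` says that the interface point `p`
is attached to the internal point `s`. -/
def Exec (X : P → S → Prop) (E c : S → S → Prop) (p q : P) : Prop :=
  ∃ s t, X p s ∧ X q t ∧ Path E c s t

theorem exec_eq_bot (E : S → S → Prop) : Exec Eq E ⊥ = E := by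
  ext s t
  constructor
  · rintro ⟨_, _, rfl, rfl, h⟩
    cases h with
    | single h => exact h
    | cons _ hc _ => exact hc.elim
  · exact fun h => ⟨_, _, rfl, rfl, .single h⟩

/-- The inner links, together with the outer links between inner interface points. -/
def nestLink (J : Q → S → Prop) (c : S → S → Prop) (d : Q → Q → Prop) (s t : S) : Prop :=
  c s t ∨ ∃ x y, d x y ∧ J x s ∧ J y t

theorem Path.of_nest {J : Q → S → Prop} {E c : S → S → Prop} {d : Q → Q → Prop} {x y : Q}
    (h : Path (Exec J E c) d x y) : Exec J E (nestLink J c d) x y := by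
  have inner {s t : S} (h : Path E c s t) : Path E (nestLink J c d) s t := by
    induction h with
    | single hE => exact .single hE
    | cons hE hc _ ih => exact .cons hE (.inl hc) ih
  induction h with
  | single h =>
    obtain ⟨s, t, hs, ht, h⟩ := h
    exact ⟨s, t, hs, ht, inner h⟩
  | cons h hd _ ih =>
    obtain ⟨s, t, hs, ht, h⟩ := h
    obtain ⟨s', t', hs', ht', h'⟩ := ih
    exact ⟨s, t', hs, ht', (inner h).append (.inr ⟨_, _, hd, ht, hs'⟩) h'⟩

theorem Path.exists_first_exit {J : Q → S → Prop} {E c : S → S → Prop} {d : Q → Q → Prop}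
    {s t : S} {y : Q} (h : Path E (nestLink J c d) s t) (hy : J y t) :
    Path E c s t ∨
      ∃ s' x x', Path E c s s' ∧ J x s' ∧ d x x' ∧ Path (Exec J E c) d x' y := by
  induction h with
  | single hE => exact .inl (.single hE)
  | cons hE hc _ ih =>
    rcases hc, ih hy with ⟨hc | ⟨x, x', hd, hx, hx'⟩, h | ⟨s', z, z', h, hz, hd', h'⟩⟩
    · exact .inl (.cons hE hc h)
    · exact .inr ⟨s', z, z', .cons hE hc h, hz, hd', h'⟩
    · exact .inr ⟨_, x, x', .single hE, hx, hd, .single ⟨_, _, hx', hy, h⟩⟩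
    · exact .inr ⟨_, x, x', .single hE, hx, hd, .cons ⟨_, _, hx', hz, h⟩ hd' h'⟩

theorem exec_exec (X : P → Q → Prop) (J : Q → S → Prop) (E c : S → S → Prop) (d : Q → Q → Prop) :
    Exec X (Exec J E c) d = Exec (Comp X J) E (nestLink J c d) := by
  ext p q
  constructor
  · rintro ⟨x, y, hx, hy, h⟩
    obtain ⟨s, t, hs, ht, h⟩ := h.of_nest
    exact ⟨s, t, ⟨x, hx, hs⟩, ⟨y, hy, ht⟩, h⟩
  · rintro ⟨s, t, ⟨x, hx, hs⟩, ⟨y, hy, ht⟩, h⟩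
    rcases h.exists_first_exit ht with h | ⟨s', z, z', h, hz, hd, h'⟩
    · exact ⟨x, y, hx, hy, .single ⟨s, t, hs, ht, h⟩⟩
    · exact ⟨x, y, hx, hy, .cons ⟨s, s', hs, hz, h⟩ hd h'⟩

theorem path_liftRel (E c : S → S → Prop) (H d : T → T → Prop) :
    Path (Sum.LiftRel E H) (Sum.LiftRel c d) = Sum.LiftRel (Path E c) (Path H d) := by
  ext s t
  constructor
  · intro h
    induction h with
    | single h => cases h with
      | inl h => exact .inl (.single h)
      | inr h => exact .inr (.single h)
    | cons h hc _ ih =>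
      rcases h, hc, ih with ⟨⟨h⟩ | ⟨h⟩, ⟨hc⟩ | ⟨hc⟩, ⟨ih⟩ | ⟨ih⟩⟩
      · exact .inl (.cons h hc ih)
      · exact .inr (.cons h hc ih)
  · rintro (⟨h⟩ | ⟨h⟩)
    · induction h with
      | single h => exact .single (.inl h)
      | cons h hc _ ih => exact .cons (.inl h) (.inl hc) ih
    · induction h with
      | single h => exact .single (.inr h)
      | cons h hc _ ih => exact .cons (.inr h) (.inr hc) ih

theorem liftRel_exec_exec (J : P → S → Prop) (E c : S → S → Prop) (K : Q → T → Prop)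
    (H d : T → T → Prop) :
    Sum.LiftRel (Exec J E c) (Exec K H d) =
      Exec (Sum.LiftRel J K) (Sum.LiftRel E H) (Sum.LiftRel c d) := by
  ext p q
  constructor
  · rintro (⟨s, t, hs, ht, h⟩ | ⟨s, t, hs, ht, h⟩)
    · exact ⟨.inl s, .inl t, .inl hs, .inl ht, by rw [path_liftRel]; exact .inl h⟩
    · exact ⟨.inr s, .inr t, .inr hs, .inr ht, by rw [path_liftRel]; exact .inr h⟩
  · rintro ⟨s, t, hs, ht, h⟩
    rw [path_liftRel] at h
    rcases hs, ht, h with ⟨⟨hs⟩ | ⟨hs⟩, ⟨ht⟩ | ⟨ht⟩, ⟨h⟩ | ⟨h⟩⟩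
    · exact .inl ⟨_, _, hs, ht, h⟩
    · exact .inr ⟨_, _, hs, ht, h⟩

theorem Path.map {E c : S → S → Prop} {E' c' : T → T → Prop} (f : S → T)
    (hE : ∀ s t, E s t → E' (f s) (f t)) (hc : ∀ s t, c s t → c' (f s) (f t)) {s t : S}
    (h : Path E c s t) : Path E' c' (f s) (f t) := by
  induction h with
  | single h => exact .single (hE _ _ h)
  | cons h h' _ ih => exact .cons (hE _ _ h) (hc _ _ h') ih

theorem Exec.congr_equiv (e : S ≃ T) {X : P → S → Prop} {X' : P → T → Prop}
    {E c : S → S → Prop} {E' c' : T → T → Prop} (hX : ∀ p s, X p s ↔ X' p (e s))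
    (hE : ∀ s t, E s t ↔ E' (e s) (e t)) (hc : ∀ s t, c s t ↔ c' (e s) (e t)) :
    Exec X E c = Exec X' E' c' := by
  ext p q
  constructor
  · rintro ⟨s, t, hs, ht, h⟩
    exact ⟨e s, e t, (hX _ _).1 hs, (hX _ _).1 ht,
      h.map e (fun _ _ => (hE _ _).1) fun _ _ => (hc _ _).1⟩
  · rintro ⟨s, t, hs, ht, h⟩
    refine ⟨e.symm s, e.symm t, (hX _ _).2 (by simpa), (hX _ _).2 (by simpa),
      h.map e.symm (fun _ _ h => (hE _ _).2 (by simpa)) fun _ _ h => (hc _ _).2 (by simpa)⟩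

/-- The right-hand points reached from `Y` directly, or by a step in `W` and a link of `c`. If `c`
does not link points of `W` among themselves, this eliminates the box `W` from an execution. -/
def bypass (W : S → S → Prop) (c : S ⊕ T → S ⊕ T → Prop) (Y : S ⊕ T → Prop) (t : T) : Prop :=
  Y (.inr t) ∨ ∃ s s', Y (.inl s) ∧ W s s' ∧ c (.inl s') (.inr t)

section Contract

variable {W : S → S → Prop} {E : T → T → Prop} {c : S ⊕ T → S ⊕ T → Prop} {Y Z : S ⊕ T → Prop}
  {a b : S ⊕ T}

theorem Path.contract (hW : ∀ s s', W s s' → W s' s) (hc : ∀ a b, c a b → c b a)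
    (hcl : ∀ s s', ¬ c (.inl s) (.inl s')) (h : Path (Sum.LiftRel W E) c a b) (ha : Y a)
    (hb : Z b) :
    (∃ s s', Y (.inl s) ∧ W s s' ∧ Z (.inl s')) ∨
      ∃ t u, bypass W c Y t ∧ Path E (fun t => bypass W c (c (.inr t))) t u ∧ bypass W c Z u := by
  induction h generalizing Y with
  | single h =>
    rcases h with ⟨h⟩ | ⟨h⟩
    · exact .inl ⟨_, _, ha, h, hb⟩
    · exact .inr ⟨_, _, .inl ha, .single h, .inl hb⟩
  | @cons a _ _ _ h hlink _ ih =>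
    rcases h with ⟨h⟩ | ⟨h⟩
    · rcases ih hlink hb with ⟨s, _, hs, _⟩ | ⟨t, u, ht | ⟨s, _, hs, _⟩, htu, hu⟩
      · exact (hcl _ _ hs).elim
      · exact .inr ⟨t, u, .inr ⟨_, _, ha, h, ht⟩, htu, hu⟩
      · exact (hcl _ _ hs).elim
    · rcases ih hlink hb with ⟨s, s', hs, hss, hs'⟩ | ⟨t, u, ht, htu, hu⟩
      · exact .inr ⟨_, _, .inl ha, .single h, .inr ⟨s', s, hs', hW _ _ hss, hc _ _ hs⟩⟩
      · exact .inr ⟨_, u, .inl ha, .cons h ht htu, hu⟩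

theorem Path.of_contract {t u : T} (h : Path E (fun t => bypass W c (c (.inr t))) t u) :
    Path (Sum.LiftRel W E) c (.inr t) (.inr u) := by
  induction h with
  | single h => exact .single (.inr h)
  | cons h hlink _ ih =>
    rcases hlink with hlink | ⟨s, s', hs, hss, hs'⟩
    · exact .cons (.inr h) hlink ih
    · exact .cons (.inr h) hs (.cons (.inl hss) hs' ih)

theorem exec_liftRel_iff {X : P → S ⊕ T → Prop} (hW : ∀ s s', W s s' → W s' s)
    (hc : ∀ a b, c a b → c b a) (hcl : ∀ s s', ¬ c (.inl s) (.inl s')) {p q : P} :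
    Exec X (Sum.LiftRel W E) c p q ↔ (∃ s s', X p (.inl s) ∧ W s s' ∧ X q (.inl s')) ∨
      Exec (fun p => bypass W c (X p)) E (fun t => bypass W c (c (.inr t))) p q := by
  constructor
  · rintro ⟨a, b, ha, hb, h⟩
    rcases h.contract hW hc hcl ha hb with h | ⟨t, u, ht, hu, h⟩
    exacts [.inl h, .inr ⟨t, u, ht, h, hu⟩]
  · rintro (⟨s, s', hs, hs', h⟩ | ⟨t, u, ht, hu, h⟩)
    · exact ⟨_, _, hs, h, .single (.inl hs')⟩
    · have h := h.of_contract
      rcases ht, hu with ⟨ht | ⟨s, s', hs, hss, ht⟩, hu | ⟨v, v', hv, hvv, hu⟩⟩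
      · exact ⟨_, _, ht, hu, h⟩
      · exact ⟨_, _, ht, hv, h.append (hc _ _ hu) (.single (.inl (hW _ _ hvv)))⟩
      · exact ⟨_, _, hs, hu, .cons (.inl hss) ht h⟩
      · exact ⟨_, _, hs, hv,
          .cons (.inl hss) ht (h.append (hc _ _ hu) (.single (.inl (hW _ _ hvv))))⟩

end Contract

/-- `s` takes part in the relation `F`. -/
def Touches (F : S → S → Prop) (s : S) : Prop := ∃ t, F s t ∨ F t s

theorem Path.touches_left {E c : S → S → Prop} {s t : S} (h : Path E c s t) : Touches E s := by
  cases h with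
  | single h => exact ⟨_, .inl h⟩
  | cons h _ _ => exact ⟨_, .inl h⟩

theorem Path.touches_right {E c : S → S → Prop} {s t : S} (h : Path E c s t) : Touches E t := by
  induction h with
  | single h => exact ⟨_, .inr h⟩
  | cons _ _ _ ih => exact ih

theorem Touches.of_exec {X : P → S → Prop} {E c : S → S → Prop} {p : P}
    (h : Touches (Exec X E c) p) : ∃ s, X p s ∧ Touches E s := by
  obtain ⟨q, ⟨s, _, hs, _, h⟩ | ⟨_, t, _, ht, h⟩⟩ := h
  exacts [⟨s, hs, h.touches_left⟩, ⟨t, ht, h.touches_right⟩]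

theorem touches_liftRel_inl {E : S → S → Prop} {K : T → T → Prop} {s : S} :
    Touches (Sum.LiftRel E K) (.inl s) ↔ Touches E s := by
  simp [Touches]

theorem touches_liftRel_inr {E : S → S → Prop} {K : T → T → Prop} {t : T} :
    Touches (Sum.LiftRel E K) (.inr t) ↔ Touches K t := by
  simp [Touches]

end Exec

end StrictLambda

namespace StrictLambda

/-! ### Port relations -/

open Relation Move Function

/-- The points of a box with ports named by `V`: its own moves, and the moves at its ports. -/
inductive Point (V : Type*) where
  | out (x : Move) : Point V
  | port (v : V) (x : Move) : Point V

/-- Open versions of partial involutions: relations on moves that may also use ports. -/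
abbrev PortRel (V : Type*) := Point V → Point V → Prop

namespace PortRel

open Point

variable {X : Frag} {V S : Type*} {W : Move → Move → Prop}

/-- The relation on moves `W`, without ports. -/
def const (W : Move → Move → Prop) : PortRel V := Relation.Map W out out

/-- The attachment of the points of an application `F G` to those of `F` and `G`. -/
def appExt : Point V → Point V ⊕ Point V → Prop
  | out x, s => s = .inl (out (r x))
  | port v x, s => s = .inl (port v x) ∨ s = .inr (port v x)

/-- The links between `F` and `G` in an application `F G`. -/
def appLink : Point V ⊕ Point V → Point V ⊕ Point V → Prop
  | .inl p, .inr q => ∃ x, p = out (l x) ∧ q = out x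
  | .inr q, .inl p => ∃ x, p = out (l x) ∧ q = out x
  | _, _ => False

/-- Application. On relations without ports it is linear application. -/
def app (F G : PortRel V) : PortRel V := Exec appExt (Sum.LiftRel F G) appLink

theorem app_exec_left (X : Point V → S → Prop) (E c : S → S → Prop) (G : PortRel V) :
    app (Exec X E c) G = Exec (Comp appExt (Sum.LiftRel X Eq)) (Sum.LiftRel E G)
      (nestLink (Sum.LiftRel X Eq) (Sum.LiftRel c ⊥) appLink) := by
  rw [← exec_exec, ← liftRel_exec_exec, exec_eq_bot, app]

theorem app_exec_right (F : PortRel V) (X : Point V → S → Prop) (E c : S → S → Prop) :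
    app F (Exec X E c) = Exec (Comp appExt (Sum.LiftRel Eq X)) (Sum.LiftRel F E)
      (nestLink (Sum.LiftRel Eq X) (Sum.LiftRel ⊥ c) appLink) := by
  rw [← exec_exec, ← liftRel_exec_exec, exec_eq_bot, app]

theorem const_eq_exec (W : Move → Move → Prop) :
    (const W : PortRel V) = Exec (fun p x => p = out x) W ⊥ := by
  ext p q
  constructor
  · rintro ⟨x, y, h, rfl, rfl⟩
    exact ⟨x, y, rfl, rfl, .single h⟩
  · rintro ⟨x, y, rfl, rfl, h⟩
    cases h with
    | single h => exact ⟨x, y, h, rfl, rfl⟩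
    | cons _ hc _ => exact hc.elim

theorem comp_appExt_out {J : Point V ⊕ Point V → S → Prop} {x : Move} {s : S} :
    Comp appExt J (out x) s ↔ J (.inl (out (r x))) s := by
  simp [Comp, appExt]

theorem comp_appExt_port {J : Point V ⊕ Point V → S → Prop} {v : V} {x : Move} {s : S} :
    Comp appExt J (port v x) s ↔ J (.inl (port v x)) s ∨ J (.inr (port v x)) s := by
  simp [Comp, appExt, or_and_right, exists_or]

theorem nestLink_appLink {J : Point V ⊕ Point V → S → Prop} {c : S → S → Prop} {s t : S} :
    nestLink J c appLink s t ↔ c s t ∨ (∃ x, J (.inl (out (l x))) s ∧ J (.inr (out x)) t) ∨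
      ∃ x, J (.inr (out x)) s ∧ J (.inl (out (l x))) t := by
  refine or_congr_right ⟨?_, ?_⟩
  · rintro ⟨_ | _, _ | _, h, hs, ht⟩
    · exact h.elim
    · obtain ⟨x, rfl, rfl⟩ := h
      exact .inl ⟨x, hs, ht⟩
    · obtain ⟨x, rfl, rfl⟩ := h
      exact .inr ⟨x, hs, ht⟩
    · exact h.elim
  · rintro (⟨x, hs, ht⟩ | ⟨x, hs, ht⟩)
    · exact ⟨.inl _, .inr _, ⟨x, rfl, rfl⟩, hs, ht⟩
    · exact ⟨.inr _, .inl _, ⟨x, rfl, rfl⟩, hs, ht⟩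

/-- The action of a map of moves on the points outside the ports. -/
def mapOut (f : Move → Move) : Point V → Point V
  | out x => out (f x)
  | port v x => port v x

/-- The attachment of interface points to the points of `W` and of its arguments in `host`. -/
def hostExt (o : Move → Move) (pos : S → Point V) : Point V → Move ⊕ S → Prop
  | out x, s => s = .inl (o x)
  | port v x, s => ∃ t, s = .inr t ∧ pos t = port v x

/-- The links between the moves of `W` and the points of its arguments in `host`. -/
def hostLink (pos : S → Point V) : Move ⊕ S → Move ⊕ S → Prop
  | .inl x, .inr s => pos s = out x
  | .inr s, .inl x => pos s = out x
  | _, _ => False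

/-- The application of a relation on moves `W` to arguments that are collected in `E`. A point `s`
of the arguments is attached to the move or port `pos s`, and the output `x` to the move `o x` of
`W`. -/
def host (W : Move → Move → Prop) (o : Move → Move) (pos : S → Point V) (E : S → S → Prop) :
    PortRel V :=
  Exec (hostExt o pos) (Sum.LiftRel W E) (hostLink pos)

theorem app_const (W : Move → Move → Prop) (F : PortRel V) :
    app (const W) F = host W r (mapOut l) F := by
  rw [const_eq_exec, app_exec_left]
  refine Exec.congr_equiv (Equiv.refl _) ?_ (fun _ _ => Iff.rfl) ?_
  · rintro (x | ⟨v, x⟩) (y | y | ⟨u, y⟩) <;>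
      simp [comp_appExt_out, comp_appExt_port, hostExt, mapOut, eq_comm]
  · rintro (x | x | ⟨v, x⟩) (y | y | ⟨u, y⟩) <;>
      simp [nestLink_appLink, hostLink, mapOut, eq_comm]

theorem app_host (W : Move → Move → Prop) (o : Move → Move) (pos : S → Point V)
    (E : S → S → Prop) (G : PortRel V) :
    app (host W o pos E) G =
      host W (o ∘ r) (Sum.elim pos (mapOut (o ∘ l))) (Sum.LiftRel E G) := by
  rw [host, app_exec_left]
  refine Exec.congr_equiv (Equiv.sumAssoc _ _ _) ?_ ?_ ?_
  · rintro (x | ⟨v, x⟩) ((y | y) | y | ⟨u, y⟩) <;>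
      simp [comp_appExt_out, comp_appExt_port, hostExt, mapOut, eq_comm]
  · rintro ((x | x) | x) ((y | y) | y) <;> simp
  · rintro ((x | x) | x | ⟨v, x⟩) ((y | y) | y | ⟨u, y⟩) <;>
      simp [nestLink_appLink, hostLink, hostExt, mapOut, eq_comm]

theorem const_out_out {x y : Move} : const (V := V) W (out x) (out y) ↔ W x y := by
  simp [const, Relation.Map]

theorem not_const_port_left {v : V} {x : Move} {p : Point V} : ¬ const W (port v x) p := by
  simp [const, Relation.Map]

theorem not_const_port_right {v : V} {x : Move} {p : Point V} : ¬ const W p (port v x) := by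
  simp [const, Relation.Map]

/-- The attachment of interface points to points of the arguments of `host`, where outputs pass
through `W`. -/
def hostEntry (W : Move → Move → Prop) (o : Move → Move) (pos : S → Point V) :
    Point V → S → Prop
  | out x, s => const W (out (o x)) (pos s)
  | port v x, s => pos s = port v x

theorem host_iff {o : Move → Move} {pos : S → Point V} {E : S → S → Prop}
    (hW : ∀ x y, W x y → W y x) {p q : Point V} :
    host W o pos E p q ↔ (∃ x y, p = out x ∧ q = out y ∧ W (o x) (o y)) ∨
      Exec (hostEntry W o pos) E (const W on pos) p q := by
  have entry : (fun p => bypass W (hostLink pos) (hostExt o pos p)) = hostEntry W o pos := by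
    ext (x | ⟨v, x⟩) s <;>
      simp [bypass, hostLink, hostExt, hostEntry, const, Relation.Map, eq_comm]
  have step : (fun s => bypass W (hostLink pos) (hostLink pos (.inr s))) = (const W on pos) := by
    ext s t
    simp only [bypass, hostLink, onFun, const, Relation.Map, false_or]
    grind
  rw [host, exec_liftRel_iff hW, entry, step]
  · refine or_congr ?_ Iff.rfl
    rcases p with x | ⟨v, x⟩ <;> rcases q with y | ⟨u, y⟩ <;> simp [hostExt]
  · rintro (x | s) (y | t) h
    exacts [h, h, h, h]
  · exact fun _ _ h => h

theorem host_eq_exec {o : Move → Move} {pos : S → Point V} {E : S → S → Prop}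
    (hW : ∀ x y, W x y → W y x) (ho : ∀ x y, ¬ W (o x) (o y)) :
    host W o pos E = Exec (hostEntry W o pos) E (const W on pos) := by
  ext p q
  rw [host_iff hW, or_iff_right]
  rintro ⟨x, y, -, -, h⟩
  exact ho x y h

/-- The combinators, as relations without ports. -/
def comb {X : Frag} (k : Comb X) : PortRel V := const (PInv.comb k).rel

theorem app_I (F : PortRel V) : app (comb (X := X) .I) F = F := by
  rw [comb, app_const, host_eq_exec fun _ _ => (PInv.comb _).symm]
  · conv_rhs => rw [← exec_eq_bot F]
    refine Exec.congr_equiv (Equiv.refl _) ?_ (fun _ _ => Iff.rfl) ?_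
    · rintro (x | ⟨v, x⟩) (y | ⟨u, y⟩) <;>
        simp [hostEntry, mapOut, const_out_out, not_const_port_right, PInv.comb, PInv.pairs,
          eq_comm]
    · rintro (x | ⟨v, x⟩) (y | ⟨u, y⟩) <;>
        simp [onFun, mapOut, const_out_out, not_const_port_right, not_const_port_left, PInv.comb,
          PInv.pairs]
  · simp [PInv.comb, PInv.pairs]

theorem app_B (F G H : PortRel V) :
    app (app (app (comb (X := X) .B) F) G) H = app F (app G H) := by
  rw [comb, app_const, app_host, app_host, host_eq_exec fun _ _ => (PInv.comb _).symm]
  · rw [app.eq_def G H, app_exec_right]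
    refine Exec.congr_equiv (Equiv.sumAssoc _ _ _) ?_ ?_ ?_
    · rintro (x | ⟨v, x⟩) (((y | ⟨u, y⟩) | y | ⟨u, y⟩) | y | ⟨u, y⟩) <;>
        simp [hostEntry, mapOut, const_out_out, not_const_port_right, PInv.comb, PInv.pairs,
          comp_appExt_out, comp_appExt_port, appExt, eq_comm]
    · rintro ((x | x) | x) ((y | y) | y) <;> simp
    · rintro (((x | ⟨v, x⟩) | x | ⟨v, x⟩) | x | ⟨v, x⟩) (((y | ⟨u, y⟩) | y | ⟨u, y⟩) | y | ⟨u, y⟩)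
        <;> simp [onFun, mapOut, const_out_out, not_const_port_left, not_const_port_right,
          PInv.comb, PInv.pairs, nestLink_appLink, appExt, appLink, eq_comm, and_comm]
  · simp [PInv.comb, PInv.pairs]

theorem app_C (F G H : PortRel V) :
    app (app (app (comb (X := X) .C) F) G) H = app (app F H) G := by
  rw [comb, app_const, app_host, app_host, host_eq_exec fun _ _ => (PInv.comb _).symm]
  · rw [app.eq_def F H, app_exec_left]
    let swapLast {S : Type _} : (S ⊕ S) ⊕ S ≃ (S ⊕ S) ⊕ S := (Equiv.sumAssoc S S S).trans
      (((Equiv.refl S).sumCongr (Equiv.sumComm S S)).trans (Equiv.sumAssoc S S S).symm)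
    refine Exec.congr_equiv swapLast ?_ ?_ ?_
    · rintro (x | ⟨v, x⟩) (((y | ⟨u, y⟩) | y | ⟨u, y⟩) | y | ⟨u, y⟩) <;>
        simp [swapLast, hostEntry, mapOut, const_out_out, not_const_port_right, PInv.comb,
          PInv.pairs, comp_appExt_out, comp_appExt_port, appExt, eq_comm]
    · rintro ((x | x) | x) ((y | y) | y) <;> simp [swapLast]
    · rintro (((x | ⟨v, x⟩) | x | ⟨v, x⟩) | x | ⟨v, x⟩) (((y | ⟨u, y⟩) | y | ⟨u, y⟩) | y | ⟨u, y⟩)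
        <;> simp [swapLast, onFun, mapOut, const_out_out, not_const_port_left, not_const_port_right,
          PInv.comb, PInv.pairs, nestLink_appLink, appExt, appLink, eq_comm, and_comm]
  · simp [PInv.comb, PInv.pairs]

end PortRel

end StrictLambda

namespace StrictLambda

/-! ### Generic arguments -/

open Relation Move Function

/-- Moves of a function of `n` arguments: `rⁱ(l x)` with `i < n` belongs to an argument, and
`rⁿ x` to the result. -/
def Move.InArity : ℕ → Move → Prop
  | 0, _ => True
  | _ + 1, l _ => True
  | n + 1, r x => x.InArity n
  | _ + 1, _ => False

theorem Move.InArity.mono {m n : ℕ} {x : Move} (hx : x.InArity n) (h : m ≤ n) : x.InArity m := by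
  induction m generalizing n x with
  | zero => trivial
  | succ m ih =>
    obtain ⟨n, rfl⟩ := Nat.exists_eq_add_of_le' h
    cases x with
    | e => exact hx
    | l x => trivial
    | r x => exact ih (n := n + m) hx (Nat.le_add_left ..)
    | pair x y => exact hx

namespace PortRel

open Point

variable {X : Frag} {V : Type*} {F G : PortRel V} {v : V}

theorem app_const_const (f g : PInv) :
    app (V := V) (const f.rel) (const g.rel) = const (f.app g).rel := by
  have entry : Comp (hostEntry f.rel r (mapOut l)) (fun p x => p = out x) =
      fun (p : Point V) y => ∃ x, p = out x ∧ f.part r l x y := by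
    ext (x | ⟨v, x⟩) y <;> simp [Comp, hostEntry, mapOut, const_out_out, PInv.part]
  have link : nestLink (fun (p : Point V) x => p = out x) ⊥ (const f.rel on mapOut l) =
      f.part l l := by
    ext x y
    simp [nestLink, onFun, mapOut, const_out_out, PInv.part]
  ext p q
  rw [app_const, host_iff fun _ _ => f.symm, const_eq_exec g.rel, exec_exec, entry, link]
  constructor
  · rintro (⟨x, y, rfl, rfl, h⟩ | ⟨s, t, ⟨x, rfl, hx⟩, ⟨y, rfl, hy⟩, h⟩)
    · exact const_out_out.2 (.inl h)
    · obtain ⟨u, hsu, hut⟩ := path_eq_comp _ _ ▸ h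
      exact const_out_out.2 (.inr ⟨t, ⟨u, ⟨s, hx, hsu⟩, hut⟩, f.symm hy⟩)
  · rintro ⟨x, y, h | ⟨t, ⟨u, ⟨s, hx, hsu⟩, hut⟩, hy⟩, rfl, rfl⟩
    · exact .inl ⟨x, y, rfl, rfl, h⟩
    · exact .inr ⟨s, t, ⟨x, rfl, hx⟩, ⟨y, rfl, f.symm hy⟩, path_eq_comp _ _ ▸ ⟨u, hsu, hut⟩⟩

theorem const_injective : Injective fun f : PInv => const (V := V) f.rel := by
  intro f g h
  ext x y
  rw [← const_out_out (V := V) (W := f.rel), ← const_out_out (V := V) (W := g.rel)]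
  exact iff_of_eq (congrFun₂ h _ _)

theorem touches_of_app_out {x : Move} (h : Touches (app F G) (out x)) :
    Touches F (out (r x)) := by
  obtain ⟨_, rfl, h⟩ := h.of_exec
  exact touches_liftRel_inl.1 h

theorem touches_of_app_port {x : Move} (h : Touches (app F G) (port v x)) :
    Touches F (port v x) ∨ Touches G (port v x) := by
  obtain ⟨_, rfl | rfl, h⟩ := h.of_exec
  exacts [.inl (touches_liftRel_inl.1 h), .inr (touches_liftRel_inr.1 h)]

/-- The ports that are in use. -/
def ports (F : PortRel V) : Set V := {v | ∃ x, Touches F (port v x)}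

theorem ports_app_subset (F G : PortRel V) : ports (app F G) ⊆ ports F ∪ ports G := by
  rintro v ⟨x, h⟩
  exact (touches_of_app_port h).imp (fun h => ⟨x, h⟩) fun h => ⟨x, h⟩

theorem ports_const (W : Move → Move → Prop) : ports (const W : PortRel V) = ∅ := by
  refine Set.eq_empty_of_forall_notMem ?_
  rintro v ⟨x, p, h | h⟩
  exacts [not_const_port_left h, not_const_port_right h]

/-- The wire that copies the moves at the port `v`. -/
def wire (v : V) : PortRel V
  | out x, port u y => u = v ∧ x = y
  | port u x, out y => u = v ∧ x = y
  | _, _ => False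

theorem ports_wire_subset (v : V) : ports (wire v) ⊆ {v} := by
  rintro u ⟨x, y | ⟨w, y⟩, h | h⟩
  exacts [h.1, h.1, h.elim, h.elim]

/-- The attachment of the points of `F` in `F (wire v)`: its inputs `l x` are visible at `v`. -/
def wireExt (v : V) : Point V → Point V → Prop
  | out x, s => s = out (r x)
  | port u x, s => s = port u x ∨ (u = v ∧ s = out (l x))

theorem app_wire (F : PortRel V) (v : V) : app F (wire v) = Exec (wireExt v) F ⊥ := by
  have swap : app F (wire v) = Exec (fun p s => appExt p s.swap) (Sum.LiftRel (wire v) F)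
      (appLink on Sum.swap) := by
    refine Exec.congr_equiv (Equiv.sumComm _ _) ?_ ?_ ?_
    · simp
    · rintro (s | s) (t | t) <;> simp
    · simp [onFun]
  have ext : (fun p : Point V => bypass (wire v) (appLink on Sum.swap) fun s => appExt p s.swap) =
      wireExt v := by
    ext (x | ⟨u, x⟩) (s | ⟨w, s⟩) <;> simp [bypass, appExt, wireExt, wire, appLink, onFun]
  have link : (fun t => bypass (wire v) (appLink on Sum.swap)
      ((appLink (V := V) on Sum.swap) (.inr t))) = ⊥ := by
    ext s t
    constructor
    · rintro (h | ⟨_, _, ⟨x, -, rfl⟩, h, y, -, rfl⟩)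
      exacts [h, h]
    · exact False.elim
  ext p q
  rw [swap, exec_liftRel_iff, ext, link, or_iff_right]
  · rintro ⟨s, s', hs, hss, hs'⟩
    rcases p, q with ⟨x | ⟨u, x⟩, y | ⟨w, y⟩⟩ <;>
      simp only [appExt, Sum.swap_inl, reduceCtorEq, Sum.inr.injEq, false_or] at hs hs'
    subst hs hs'
    exact hss
  · rintro (x | ⟨u, x⟩) (y | ⟨w, y⟩) h
    exacts [h, ⟨h.1, h.2.symm⟩, ⟨h.1, h.2.symm⟩, h]
  · rintro (x | x) (y | y) h
    exacts [h, h, h, h]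
  · exact fun _ _ h => h

/-- `F` is a function of `n` arguments: its moves are those of one of the arguments or of the
result. -/
def HasArity (n : ℕ) (F : PortRel V) : Prop := ∀ x, Touches F (out x) → x.InArity n

theorem HasArity.mono {m n : ℕ} (hF : HasArity n F) (h : m ≤ n) : HasArity m F :=
  fun x hx => (hF x hx).mono h

theorem HasArity.apply {n : ℕ} (hF : HasArity (n + 1) F) (G : PortRel V) : HasArity n (app F G) :=
  fun _ hx => hF _ (touches_of_app_out hx)

theorem HasArity.exists_wireExt (hF : HasArity 1 F) (v : V) {s : Point V}
    (hs : Touches F s) : ∃ p, wireExt v p s := by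
  rcases s with (_ | x | x | _) | ⟨u, x⟩
  · exact (hF _ hs).elim
  · exact ⟨port v x, .inr ⟨rfl, rfl⟩⟩
  · exact ⟨out x, rfl⟩
  · exact (hF _ hs).elim
  · exact ⟨port u x, .inl rfl⟩

theorem wireExt_unique {p s t : Point V} (hs : wireExt v p s) (ht : wireExt v p t)
    (hsv : ∀ x, s ≠ port v x) (htv : ∀ x, t ≠ port v x) : s = t := by
  rcases p with x | ⟨u, x⟩
  · exact hs.trans ht.symm
  · rcases hs, ht with ⟨rfl | ⟨rfl, rfl⟩, rfl | ⟨h, rfl⟩⟩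
    exacts [rfl, (hsv x (h ▸ rfl)).elim, (htv x rfl).elim, rfl]

theorem HasArity.le_of_app_wire_le (hF : HasArity 1 F)
    (hvF : v ∉ ports F) (hvG : v ∉ ports G) (h : app F (wire v) ≤ app G (wire v)) : F ≤ G := by
  intro s t hst
  obtain ⟨p, hp⟩ := hF.exists_wireExt v ⟨t, .inl hst⟩
  obtain ⟨q, hq⟩ := hF.exists_wireExt v ⟨s, .inr hst⟩
  rw [app_wire, app_wire] at h
  obtain ⟨s', t', hs', ht', hst'⟩ := h p q ⟨s, t, hp, hq, .single hst⟩
  cases hst' with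
  | cons _ hc _ => exact hc.elim
  | single hst' =>
    obtain rfl : s = s' := wireExt_unique hp hs' (by rintro x rfl; exact hvF ⟨x, _, .inl hst⟩)
      (by rintro x rfl; exact hvG ⟨x, _, .inl hst'⟩)
    obtain rfl : t = t' := wireExt_unique hq ht' (by rintro x rfl; exact hvF ⟨x, _, .inr hst⟩)
      (by rintro x rfl; exact hvG ⟨x, _, .inr hst'⟩)
    exact hst'

theorem HasArity.eq_of_app_wire_eq (hF : HasArity 1 F) (hG : HasArity 1 G)
    (hvF : v ∉ ports F) (hvG : v ∉ ports G) (h : app F (wire v) = app G (wire v)) : F = G :=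
  le_antisymm (hF.le_of_app_wire_le hvF hvG h.le) (hG.le_of_app_wire_le hvG hvF h.ge)

theorem hasArity_comb {k : Comb X} {n : ℕ}
    (hk : ∀ x y, PInv.pairs k x y → x.InArity n ∧ y.InArity n) :
    HasArity n (comb k : PortRel V) := by
  have key {x y : Move} (h : (PInv.comb k).rel x y) : x.InArity n ∧ y.InArity n :=
    h.elim (hk x y) fun h => (hk y x h).symm
  rintro x ⟨y | ⟨v, y⟩, h | h⟩
  · exact (key (const_out_out.1 h)).1
  · exact (key (const_out_out.1 h)).2
  · exact (not_const_port_right h).elim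
  · exact (not_const_port_left h).elim

theorem hasArity_I : HasArity 1 (comb (X := X) .I : PortRel V) :=
  hasArity_comb <| by rintro _ _ ⟨x, rfl, rfl⟩; exact ⟨trivial, trivial⟩

theorem hasArity_B : HasArity 3 (comb (X := X) .B : PortRel V) :=
  hasArity_comb <| by
    rintro _ _ ⟨x, ⟨rfl, rfl⟩ | ⟨rfl, rfl⟩ | ⟨rfl, rfl⟩⟩ <;> exact ⟨trivial, trivial⟩

theorem hasArity_C : HasArity 3 (comb (X := X) .C : PortRel V) :=
  hasArity_comb <| by
    rintro _ _ ⟨x, ⟨rfl, rfl⟩ | ⟨rfl, rfl⟩ | ⟨rfl, rfl⟩⟩ <;> exact ⟨trivial, trivial⟩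

end PortRel

end StrictLambda

namespace StrictLambda

/-! ### The combinatory model of port relations -/

open Function

/-- Port relations that use finitely many ports. -/
abbrev FinPortRel (V : Type*) := {F : PortRel V // (PortRel.ports F).Finite}

namespace FinPortRel

open PortRel CombStructure

variable {X : Frag} {V : Type*} {F G : FinPortRel V}

/-- The structure of port relations with finitely many ports. -/
def algebra (X : Frag) (V : Type*) : CombStructure X (FinPortRel V) where
  app F G := ⟨app F.1 G.1, (F.2.union G.2).subset (ports_app_subset _ _)⟩
  comb k := ⟨PortRel.comb k, by simp only [PortRel.comb, ports_const, Set.finite_empty]⟩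

/-- Partial involutions as port relations. -/
def ofPInv (V : Type*) (f : PInv) : FinPortRel V :=
  ⟨const f.rel, by simp only [ports_const, Set.finite_empty]⟩

theorem isHom_ofPInv (X : Frag) (V : Type*) :
    (PInv.structureP X).IsHom (algebra X V) (ofPInv V) where
  map_app f g := Subtype.ext (app_const_const f g).symm
  map_comb _ := rfl

theorem ofPInv_injective (V : Type*) : Injective (ofPInv V) :=
  fun _ _ h => const_injective (congrArg Subtype.val h)

theorem satisfiesBCI (X : Frag) (V : Type*) : (algebra X V).SatisfiesBCI where
  B_law F G H := Subtype.ext (app_B F.1 G.1 H.1)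
  C_law F G H := Subtype.ext (app_C F.1 G.1 H.1)
  I_law F := Subtype.ext (app_I F.1)

/-- A wire at an unused port is a generic argument, which determines the function. -/
theorem ext_of_hasArity [Infinite V] (hF : HasArity 1 F.1) (hG : HasArity 1 G.1)
    (h : ∀ H, (algebra X V).app F H = (algebra X V).app G H) : F = G := by
  obtain ⟨v, hv⟩ := (F.2.union G.2).exists_notMem
  rw [Set.mem_union, not_or] at hv
  let H : FinPortRel V := ⟨wire v, (Set.finite_singleton v).subset (ports_wire_subset v)⟩
  exact Subtype.ext (hF.eq_of_app_wire_eq hG hv.1 hv.2 (congrArg Subtype.val (h H)))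

/-- The selector `BI = λxy.xy`. -/
def selector (X : Frag) (V : Type*) : FinPortRel V :=
  (algebra X V).app ((algebra X V).comb .B) ((algebra X V).comb .I)

theorem hasArity_selector_app (F : FinPortRel V) :
    HasArity 1 ((algebra X V).app (selector X V) F).1 :=
  (hasArity_B.apply _).apply _

theorem selector_app_app (F G : FinPortRel V) :
    (algebra X V).app ((algebra X V).app (selector X V) F) G = (algebra X V).app F G := by
  rw [selector, (satisfiesBCI X V).B_law, (satisfiesBCI X V).I_law]

theorem isSelector (X : Frag) (V : Type*) [Infinite V] :
    (algebra X V).IsSelector (selector X V) :=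
  ⟨selector_app_app, fun F G h =>
    ext_of_hasArity (hasArity_selector_app F) (hasArity_selector_app G) fun H => by
      rw [selector_app_app, h, selector_app_app]⟩

theorem abs_eq_of_hasArity [Infinite V] {f : FinPortRel V → FinPortRel V} (hF : HasArity 1 F.1)
    (h : ∀ G, (algebra X V).app F G = f G) : (algebra X V).abs (selector X V) f = F := by
  rw [(isSelector X V).abs_eq h]
  exact ext_of_hasArity (hasArity_selector_app F) hF (selector_app_app F)

theorem isStable (V : Type*) [Infinite V] :
    (algebra .linear V).IsStable (selector .linear V) := by
  have hBCI := satisfiesBCI .linear V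
  rintro (_ | _ | _) ρ <;> simp only [Comb.toLam, den]
  · refine abs_eq_of_hasArity (hasArity_B.mono (by decide)) fun F => ?_
    refine (abs_eq_of_hasArity ((hasArity_B.apply _).mono (by decide)) fun G => ?_).symm
    exact (abs_eq_of_hasArity ((hasArity_B.apply _).apply _) fun H => hBCI.B_law F G H).symm
  · refine abs_eq_of_hasArity (hasArity_C.mono (by decide)) fun F => ?_
    refine (abs_eq_of_hasArity ((hasArity_C.apply _).mono (by decide)) fun G => ?_).symm
    exact (abs_eq_of_hasArity ((hasArity_C.apply _).apply _) fun H => hBCI.C_law F G H).symm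
  · exact abs_eq_of_hasArity hasArity_I hBCI.I_law

end FinPortRel

namespace PInv

theorem satisfiesBCI (X : Frag) : (structureP X).SatisfiesBCI :=
  .of_injective (FinPortRel.isHom_ofPInv X ℕ) (FinPortRel.ofPInv_injective ℕ)
    (FinPortRel.satisfiesBCI X ℕ)

theorem isLambdaAlgebra_linear : (structureP .linear).IsLambdaAlgebra :=
  ⟨satisfiesBCI .linear, fun _ _ _ _ h => (FinPortRel.isHom_ofPInv .linear ℕ).interp_eq_of_eqv
    (FinPortRel.ofPInv_injective ℕ) (FinPortRel.satisfiesBCI .linear ℕ)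
    (FinPortRel.isSelector .linear ℕ) (FinPortRel.isStable ℕ) h⟩

end PInv

end StrictLambda

namespace StrictLambda

/-! ### Selectors and weakening in partial involutions -/

namespace PInv

open Move

theorem comb_K_rel {u v : Move} : (comb .K).rel u v ↔
    ∃ x, u = l x ∧ v = r (r x) ∨ u = r (r x) ∧ v = l x := by
  simp only [comb, pairs, ← exists_or, and_comm]

theorem app_K_rel {f : PInv} {u v : Move} :
    (app (comb .K) f).rel u v ↔ ∃ x y, u = r x ∧ v = r y ∧ f.rel x y := by
  constructor
  · rintro (h | ⟨d, ⟨b, ⟨a, hua, hab⟩, hloop⟩, hdv⟩)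
    · simp [part, comb_K_rel] at h
    · rcases Relation.ReflTransGen.cases_head hloop with rfl | ⟨_, ⟨_, h, _⟩, _⟩
      · obtain ⟨x, rfl, rfl⟩ : ∃ x, u = r x ∧ a = x := by simpa [part, comb_K_rel] using hua
        obtain ⟨y, rfl, rfl⟩ : ∃ y, b = y ∧ v = r y := by simpa [part, comb_K_rel] using hdv
        exact ⟨_, _, rfl, rfl, hab⟩
      · simp [part, comb_K_rel] at h
  · rintro ⟨x, y, rfl, rfl, h⟩
    exact .inr ⟨y, ⟨y, ⟨x, comb_K_rel.2 ⟨x, .inr ⟨rfl, rfl⟩⟩, h⟩, .refl⟩,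
      comb_K_rel.2 ⟨y, .inl ⟨rfl, rfl⟩⟩⟩

theorem app_app_K (f g : PInv) : app (app (comb .K) f) g = f := by
  ext u v
  constructor
  · rintro (h | ⟨_, ⟨_, ⟨_, h, _⟩, _⟩, _⟩)
    · obtain ⟨_, _, ⟨⟩, ⟨⟩, h⟩ := app_K_rel.1 h
      exact h
    · obtain ⟨_, _, _, ⟨⟩, _⟩ := app_K_rel.1 h
  · exact fun h => .inl (app_K_rel.2 ⟨_, _, rfl, rfl, h⟩)

/-- The partial involution with the single pair `a ↔ b`. -/
def single (a b : Move) : PInv where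
  rel u v := u = a ∧ v = b ∨ u = b ∧ v = a
  symm := by tauto
  functional := by grind

/-- The empty partial involution. -/
def empty : PInv where
  rel _ _ := False
  symm := id
  functional := nofun

theorem app_empty_rel {f : PInv} {u v : Move} : (app f empty).rel u v ↔ f.rel (r u) (r v) :=
  ⟨fun h => h.resolve_right fun ⟨_, ⟨_, ⟨_, _, h⟩, _⟩, _⟩ => h, .inl⟩

theorem app_single_l_l (a b : Move) (f : PInv) : app (single (l a) (l b)) f = app empty f := by
  ext u v
  constructor <;> rintro (h | ⟨_, ⟨_, ⟨_, h, _⟩, _⟩, _⟩) <;> simp [part, single, empty] at h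

section Selector

variable {ε : PInv}

theorem rel_r_r_e_of_app_app (h_app : ∀ x y, app (app ε x) y = app x y) :
    ε.rel (r (r e)) (l (r e)) := by
  have hε : ¬ ε.rel (r (r e)) (r (r e)) := by
    rw [← app_empty_rel, ← app_empty_rel, h_app, app_empty_rel]
    exact id
  have hx : (app ε (single (r e) (r e))).rel (r e) (r e) := by
    rw [← app_empty_rel, h_app, app_empty_rel]
    exact .inl ⟨rfl, rfl⟩
  obtain h | ⟨_, ⟨_, ⟨p, h, hp⟩, _⟩, _⟩ := hx
  · exact absurd h hε
  · obtain rfl : p = r e := hp.elim And.left And.left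
    exact h

theorem app_single_rel_of_app_app (h_app : ∀ x y, app (app ε x) y = app x y) :
    (app ε (single (r e) (l e))).rel (r e) (l e) := by
  have h_empty : ¬ (app ε (single (r e) (l e))).rel (r e) (r e) := by
    rw [← app_empty_rel, h_app, app_empty_rel]
    simp [single]
  have h_single : (app (app ε (single (r e) (l e))) (single e e)).rel e e := by
    rw [h_app]
    exact .inr ⟨e, ⟨e, ⟨e, .inl ⟨rfl, rfl⟩, .inl ⟨rfl, rfl⟩⟩, .refl⟩, .inr ⟨rfl, rfl⟩⟩
  obtain h | ⟨_, ⟨_, ⟨b, h, hb⟩, _⟩, _⟩ := h_single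
  · exact absurd h h_empty
  · obtain rfl : b = e := hb.elim And.left And.left
    exact h

theorem rel_l_l_e_of_app_app (h_app : ∀ x y, app (app ε x) y = app x y) :
    ε.rel (l (l e)) (r (l e)) := by
  have h_out := rel_r_r_e_of_app_app h_app
  obtain h | ⟨d, ⟨b, ⟨p, h, hp⟩, hloop⟩, hd⟩ := app_single_rel_of_app_app h_app
  · cases ε.functional h_out h
  · cases ε.functional h_out h
    obtain rfl : b = l e := by simpa [single] using hp
    rcases Relation.ReflTransGen.cases_head hloop with rfl | ⟨c, ⟨y, hy, hyc⟩, hloop⟩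
    · exact hd
    rcases hyc with ⟨rfl, rfl⟩ | ⟨rfl, rfl⟩
    · cases ε.functional (ε.symm h_out) (ε.symm hy)
    rcases Relation.ReflTransGen.cases_head hloop with rfl | ⟨c, ⟨y', hy', _⟩, _⟩
    · cases ε.functional (ε.symm h_out) hd
    · cases ε.functional (ε.symm h_out) hy'

end Selector

/-- A selector copies the part of its argument on `l`-moves, on which the applicative behaviour
of the argument does not depend. -/
theorem not_isSelector (ε : PInv) : ¬ (structureP .linear).IsSelector ε := by
  rintro ⟨h_app, h_ext⟩
  have h_arg : ε.rel (l (l e)) (r (l e)) := rel_l_l_e_of_app_app h_app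
  have h_eq : app ε (single (l e) (l e)) = app ε empty :=
    h_ext _ _ fun f => app_single_l_l e e f
  have h_single : (app ε (single (l e) (l e))).rel (l e) (l e) :=
    .inr ⟨_, ⟨_, ⟨_, ε.symm h_arg, .inl ⟨rfl, rfl⟩⟩, .refl⟩, h_arg⟩
  rw [h_eq, app_empty_rel] at h_single
  cases ε.functional (ε.symm h_arg) h_single

/-- The move `r (l (l e))` is answered by `BBK` but not by `BKK`. -/
theorem BBK_ne_BKK : app (app (comb (X := .affine) .B) (comb (X := .affine) .B)) (comb .K) ≠
    app (app (comb (X := .affine) .B) (comb .K)) (comb .K) := by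
  intro h_eq
  have h_rel : (app (app (comb (X := .affine) .B) (comb (X := .affine) .B)) (comb .K)).rel
      (r (l (l e))) (r (r (l e))) :=
    .inl (.inr ⟨_, ⟨_, ⟨_, .inl ⟨l (l e), .inl ⟨rfl, rfl⟩⟩,
      .inl ⟨e, .inr (.inr ⟨rfl, rfl⟩)⟩⟩, .refl⟩, .inr ⟨r (l e), .inl ⟨rfl, rfl⟩⟩⟩)
  have hB : (comb (X := .affine) .B).rel (r (r (r (l (l e))))) (l (r (l (l e)))) :=
    .inl ⟨_, .inl ⟨rfl, rfl⟩⟩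
  have h_not (v) : ¬ (app (comb (X := .affine) .B) (comb .K)).rel (r (r (l (l e)))) v := by
    rintro (h | ⟨_, ⟨_, ⟨_, h, hK⟩, _⟩, _⟩)
    · cases (comb .B).functional hB h
    · cases (comb .B).functional hB h
      simp [comb_K_rel] at hK
  rw [h_eq] at h_rel
  rcases h_rel with h | ⟨_, ⟨_, ⟨_, h, _⟩, _⟩, _⟩ <;> exact h_not _ h

end PInv

namespace LTerm

variable {X : Frag} {A : Type*}

theorem wf_toLam (k : Comb X) : WF X (k.toLam : LTerm A) := by
  cases X <;> cases k <;> simp [Comb.toLam, WF, Abstractable, occ]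

theorem rename_toLam (f : ℕ → ℕ) (k : Comb X) : rename f (k.toLam : LTerm A) = k.toLam := by
  cases k <;> rfl

theorem subst_toLam (σ : ℕ → LTerm A) (k : Comb X) : subst σ k.toLam = k.toLam := by
  cases k <;> rfl

theorem occ_toLam (n : ℕ) (k : Comb X) : occ n (k.toLam : LTerm A) = 0 := by
  cases k <;> rfl

theorem eqv_app_K {N : LTerm A} (hN : WF .affine N) :
    Eqv .affine (.app Comb.K.toLam N) (.lam (rename Nat.succ N)) :=
  .beta (wf_toLam .K) hN

theorem eqv_app_B_comb (k : Comb .affine) :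
    Eqv (A := A) .affine (.app (.B : Comb .affine).toLam k.toLam)
      (.lam (.lam (.app k.toLam (.app (.var 1) (.var 0))))) := by
  have h_beta := Eqv.beta (A := A) (wf_toLam (.B : Comb .affine)) (wf_toLam k)
  simp only [inst, subst, up, rename, rename_toLam] at h_beta
  exact h_beta

theorem eqv_app_B_comb_K (k : Comb .affine) :
    Eqv (A := A) .affine (.app (.app (.B : Comb .affine).toLam k.toLam) Comb.K.toLam)
      (.lam (.app k.toLam (.lam (.var 1)))) := by
  have h_beta : Eqv (A := A) .affine
      (.app (.lam (.lam (.app k.toLam (.app (.var 1) (.var 0))))) Comb.K.toLam)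
      (.lam (.app k.toLam (.app Comb.K.toLam (.var 0)))) := by
    have h_wf : WF (A := A) .affine (.lam (.lam (.app k.toLam (.app (.var 1) (.var 0))))) := by
      simp [WF, Abstractable, occ, occ_toLam, wf_toLam]
    have h := Eqv.beta h_wf (wf_toLam (.K : Comb .affine))
    simp only [inst, subst, up, rename_toLam, subst_toLam] at h
    exact h
  have h_K : Eqv (A := A) .affine (.app k.toLam (.app Comb.K.toLam (.var 0)))
      (.app k.toLam (.lam (.var 1))) :=
    .app (.refl (wf_toLam k)) (eqv_app_K trivial)
  refine .trans (.app (eqv_app_B_comb k) (.refl (wf_toLam _))) (.trans h_beta (.xi h_K ?_ ?_)) <;>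
    simp [Abstractable, occ, occ_toLam]

theorem eqv_app_B_lam_var :
    Eqv (A := A) .affine (.app (.B : Comb .affine).toLam (.lam (.var 1)))
      (.lam (.lam (.var 2))) := by
  have h_B : Eqv (A := A) .affine (.app (.B : Comb .affine).toLam (.lam (.var 1)))
      (.lam (.lam (.app (.lam (.var 3)) (.app (.var 1) (.var 0))))) :=
    .beta (wf_toLam .B) (by simp [WF, Abstractable, occ])
  refine .trans h_B (.xi (.xi (.beta ?_ ?_) ?_ ?_) ?_ ?_) <;> simp [WF, Abstractable, occ]

/-- Both sides reduce to `λy.λx.λz.y`, because `B` and `K` agree on the constant function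
`λx.y`. -/
theorem eqv_BBK_BKK (A : Type*) : Eqv .affine (BBK A).toLam (BKK A).toLam := by
  have h_K : Eqv (A := A) .affine (.app Comb.K.toLam (.lam (.var 1))) (.lam (.lam (.var 2))) :=
    eqv_app_K (by simp [WF, Abstractable, occ])
  refine .trans (eqv_app_B_comb_K .B) (.trans (.xi (eqv_app_B_lam_var.trans h_K.symm) ?_ ?_)
    (eqv_app_B_comb_K .K).symm) <;> simp [Abstractable, occ, occ_toLam]

end LTerm

end StrictLambda

theorem mainTheorem2 :
    ((StrictLambda.PInv.structureP .linear).IsCombAlgebra ∧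
      (StrictLambda.PInv.structureP .linear).IsLambdaAlgebra ∧
      (¬ ∃ ε : StrictLambda.PInv, (StrictLambda.PInv.structureP .linear).IsSelector ε) ∧
      ¬ (StrictLambda.PInv.structureP .linear).IsCombinatoryModel) ∧
    ((StrictLambda.PInv.structureP .affine).IsCombAlgebra ∧
      ¬ (StrictLambda.PInv.structureP .affine).IsLambdaAlgebra ∧
      StrictLambda.LTerm.Eqv .affine (StrictLambda.BBK StrictLambda.PInv).toLam
        (StrictLambda.BKK StrictLambda.PInv).toLam ∧
      ∀ ρ : ℕ → StrictLambda.PInv,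
        (StrictLambda.PInv.structureP .affine).interp ρ (StrictLambda.BBK StrictLambda.PInv) ≠
          (StrictLambda.PInv.structureP .affine).interp ρ
            (StrictLambda.BKK StrictLambda.PInv)) := by
  have h_sel : ¬ ∃ ε : StrictLambda.PInv, (StrictLambda.PInv.structureP .linear).IsSelector ε :=
    fun ⟨ε, hε⟩ => StrictLambda.PInv.not_isSelector ε hε
  have h_eqv := StrictLambda.LTerm.eqv_BBK_BKK StrictLambda.PInv
  have h_ne := StrictLambda.PInv.BBK_ne_BKK
  have h_alg := StrictLambda.PInv.isLambdaAlgebra_linear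
  refine ⟨⟨h_alg.1, h_alg, h_sel, fun h => h_sel h.2⟩,
    ⟨StrictLambda.PInv.satisfiesBCI .affine, StrictLambda.PInv.app_app_K⟩, fun h => ?_, h_eqv,
    fun _ => h_ne⟩
  exact h_ne (h.2 (StrictLambda.BBK _) (StrictLambda.BKK _) ⟨⟨trivial, trivial⟩, trivial⟩
    ⟨⟨trivial, trivial⟩, trivial⟩ h_eqv fun _ => StrictLambda.PInv.empty)
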